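/- **Model.** An IoT device is connected to $M\ge1$ MEC devices. In each time slot $k=0,1,\dots$ it has a task of $C^{(k)}>0$ bits, picks an action $\mathbf a^{(k)}=[i,x]$ with $1\le i\le M$ and $x\in\{l/N_x:0\le l\le N_x\}$, offloads $xC^{(k)}$ bits to device $i$ and computes the rest locally at CPU frequency $f>0$, using $N\geq 0$ CPU cycles per bit. With bandwidths $B_j^{(k)}>0$, transmit power $P^{(k)}$ and effective capacitance $\varsigma\ge0$ put (slot index omitted) $$T_0=\frac{(1-x)CN}{f},\quad E_0=(1-x)CN\varsigma f^2,\quad T_i=\frac{xC}{B_i},\quad E_i=\frac{PxC}{B_i}.$$ With battery level $b$, harvested energy $\rho$, and weights $\beta,\mu,\psi\ge 0$, the utility of the slot is $$U_i(x)=xC-\psi\,\mathbf I\bigl(b-(E_0+E_i)+\rho\le0\bigr)-\beta(E_0+E_i)-\mu\max\{T_0,T_i\}.$$ The state of slot $k$ consists of the previous bandwidths $B^{(k-1)}_1,\dots,B^{(k-1)}_M$, the prediction $\hat\rho^{(k)}$ of $\rho^{(k)}$ and the battery level $b^{(k)}$. Given the past and the action, $(C^{(k)},P^{(k)},B^{(k)},\rho^{(k)},\hat\rho^{(k+1)})$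 is drawn from a finite set by a law that depends only on $(B^{(k-1)},\hat\rho^{(k)})$, and $b^{(k+1)}=\Lambda\bigl(b^{(k)}-(E_0+E_i)+\rho^{(k)}\bigr)$, where $\Lambda:\mathbb R\to\mathbb R$ is nondecreasing with finitely many values (the feasible battery levels). The initial state takes finitely many values. **Scheme.** Tabular Q-learning with arbitrary initial table, discount factor $\gamma\in[0,1)$, $\varepsilon$-greedy actions with a constant $\varepsilon\in(0,1]$ (each action is explored with probability $\varepsilon/((N_x+1)M)$, and with the remaining probability $1-\varepsilon$ a maximizer of the current Q-function is taken, ties being broken arbitrarily), and learning rate $\alpha_j\in[0,1]$ at the $j$-th visit to a state-action pair, with $\sum_j\alpha_j=\infty$ and $\sum_j\alpha_j^2<\infty$. **Theorem.** Let $i^*=\arg\max_iB_i$ be a device with the largest bandwidth in the slot, and suppose that for every possible outcome of a slot $$B_{i^*}\bigl(f+\beta\varsigma Nf^3+\mu N\bigr)\le\beta Pf .$$ Then for every outcome of a slot and every battery level $b$, fully local computation $[i^*,0]$ maximizes $U_i(x)$ over all $i$ and all $x\in[0,1]$, and its utility is $$U^*=-\psi\,\mathbf I\bigl(b-\varsigma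 CNf^2+\rho\le0\bigr)-CN\Bigl(\beta\varsigma f^2+\frac{\mu}{f}\Bigr).$$ Moreover, the Q-learning scheme attains this optimum with probability 1: almost surely, writing $Q^{(k)}$ and $\mathbf s^{(k)}$ for the Q-function and the state in slot $k$, 1. $\max_{\mathbf a}Q^{(k)}(\mathbf s^{(k)},\mathbf a)-Q^{(k)}(\mathbf s^{(k)},[i^*,0])\to0$ as $k\to\infty$; 2. for all sufficiently large $k$, every maximizer $\mathbf a$ of $Q^{(k)}(\mathbf s^{(k)},\cdot)$ is an optimal action of slot $k$, and its utility in slot $k$ equals $U^*$; 3. if the displayed condition holds with strict inequality for every outcome, then for all sufficiently large $k$ every maximizer of $Q^{(k)}(\mathbf s^{(k)},\cdot)$ has $x=0$, that is, computes everything locally. -/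

import Mathlib

open MeasureTheory Filter

noncomputable section

namespace MEC

/-- The system state `[B₁,…,B_M, ρ̂, b]` observed by the IoT device at the beginning of a slot:
the bandwidths of the previous slot, the predicted harvested energy and the battery level. -/
structure State (M : ℕ) where
  B : Fin M → ℝ
  ρhat : ℝ
  b : ℝ

/-- An action `[i, x]`: the MEC device `i` and the quantized offloading rate `x = l / Nx`,
`0 ≤ l ≤ Nx`, represented by `(i, l)`. -/
abbrev Action (M Nx : ℕ) : Type := Fin M × Fin (Nx + 1)

/-- The offloading rate `x = l / Nx` of an action. -/
def rate {M Nx : ℕ} (a : Action M Nx) : ℝ := (a.2 : ℝ) / (Nx : ℝ)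

/-- The data of an offloading system with `M` MEC devices. The finite type `W` lists the possible
exogenous conditions ("outcomes") of one time slot. -/
structure Model (M : ℕ) (W : Type*) where
  /-- number of CPU cycles per input bit -/
  N : ℝ
  /-- CPU frequency used for the `m`-th cycle, `m = 1, 2, …` -/
  freq : ℕ → ℝ
  /-- effective capacitance coefficient -/
  ς : ℝ
  /-- weight of the energy consumption -/
  β : ℝ
  /-- weight of the computation delay -/
  μ : ℝ
  /-- task drop loss -/
  ψ : ℝ
  /-- task size in the slot -/
  C : W → ℝ
  /-- transmit power in the slot -/
  P : W → ℝ
  /-- bandwidths to the MEC devices in the slot -/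
  B : W → Fin M → ℝ
  /-- energy harvested in the slot -/
  ρ : W → ℝ
  /-- prediction, made at the end of the slot, of the energy harvested in the next slot -/
  ρhat : W → ℝ
  /-- law of the outcome of a slot, given the previous bandwidths and the predicted energy -/
  nature : (Fin M → ℝ) → ℝ → PMF W
  /-- the feasible battery level that represents a given amount of stored energy -/
  level : ℝ → ℝ

/-- The sum `∑_{m=1}^{n} g m` over a real number `n ≥ 0` of CPU cycles: the last, incomplete
cycle is counted proportionally. -/
def cycleSum (n : ℝ) (g : ℕ → ℝ) : ℝ :=
  ∑ m ∈ Finset.Icc 1 ⌊n⌋₊, g m + (n - (⌊n⌋₊ : ℝ)) * g (⌊n⌋₊ + 1)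

namespace Model

variable {M Nx : ℕ} {W : Type*} (sys : Model M W)

/-- Local execution latency `T₀`. -/
def localDelay (w : W) (x : ℝ) : ℝ :=
  cycleSum ((1 - x) * sys.C w * sys.N) fun m => 1 / sys.freq m

/-- Energy `E₀` for local computing. -/
def localEnergy (w : W) (x : ℝ) : ℝ :=
  cycleSum ((1 - x) * sys.C w * sys.N) fun m => sys.ς * sys.freq m ^ 2

/-- Transmission duration `T_i`. -/
def txDelay (w : W) (i : Fin M) (x : ℝ) : ℝ := x * sys.C w / sys.B w i

/-- Energy `E_i` for offloading. -/
def txEnergy (w : W) (i : Fin M) (x : ℝ) : ℝ := sys.P w * x * sys.C w / sys.B w i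

/-- The stored energy `b - (E₀ + E_i) + ρ` at the end of the slot. -/
def nextEnergy (w : W) (b : ℝ) (i : Fin M) (x : ℝ) : ℝ :=
  b - (sys.localEnergy w x + sys.txEnergy w i x) + sys.ρ w

open Classical in
/-- The utility of one slot with outcome `w`, battery level `b` and action `[i, x]`. -/
def utility (w : W) (b : ℝ) (i : Fin M) (x : ℝ) : ℝ :=
  x * sys.C w - sys.ψ * (if sys.nextEnergy w b i x ≤ 0 then 1 else 0)
    - sys.β * (sys.localEnergy w x + sys.txEnergy w i x)
    - sys.μ * max (sys.localDelay w x) (sys.txDelay w i x)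

/-- The next system state, after action `a` in a slot with outcome `w`. -/
def nextState (s : State M) (a : Action M Nx) (w : W) : State M where
  B := sys.B w
  ρhat := sys.ρhat w
  b := sys.level (sys.nextEnergy w s.b a.1 (rate a))

end Model

/-- A table of Q-values. -/
abbrev QTable (M Nx : ℕ) : Type := State M → Action M Nx → ℝ

/-- `a` maximizes the Q-function at the state `s`. -/
def IsGreedy {M Nx : ℕ} (q : QTable M Nx) (s : State M) (a : Action M Nx) : Prop :=
  ∀ a', q s a' ≤ q s a

open Classical in
/-- Number of slots before slot `n` in which the action `a` was taken in the state `s`. -/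
def visits {M Nx : ℕ} (S : ℕ → State M) (A : ℕ → Action M Nx) (n : ℕ) (s : State M)
    (a : Action M Nx) : ℕ :=
  ((Finset.range n).filter fun k => S k = s ∧ A k = a).card

open Classical in
/-- One Q-learning update with learning rate `r`: the action `a` was taken in the state `s`,
gave the utility `u` and led to the state `s'`. -/
def bellmanUpdate {M Nx : ℕ} (q : QTable M Nx) (r γ u : ℝ) (s : State M) (a : Action M Nx)
    (s' : State M) : QTable M Nx := fun t c =>
  if t = s ∧ c = a then (1 - r) * q s a + r * (u + γ * ⨆ a', q s' a') else q t c

open Classical in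
/-- Probability with which the `ε`-greedy policy takes the action `a` if `g` is its greedy action:
every action is explored with probability `ε / ((Nx + 1) M)`, and with the remaining
probability `1 - ε` the greedy action is taken. -/
def epsGreedy {M Nx : ℕ} (ε : ℝ) (g a : Action M Nx) : ℝ :=
  (if a = g then 1 - ε else 0) + ε / (((Nx : ℝ) + 1) * (M : ℝ))

open Classical in
/-- The processes `S` (states), `A` (actions), `O` (outcomes of the slots), `Q` (Q-tables) and
`G` (greedy actions, with arbitrary tie-breaking) on `Ω` are a run of the Q-learning scheme with
initial table `Q₀`, discount factor `γ`, exploration rate `ε`, and learning rate `α j` at the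
`j`-th visit (`j = 0, 1, …`) to a state-action pair; `ℱ n` is the information available when the
action of slot `n` is drawn. -/
structure IsQLearningRun {M Nx : ℕ} {W : Type*} (sys : Model M W) (α : ℕ → ℝ) (γ ε : ℝ)
    (Q₀ : QTable M Nx) {Ω : Type*} [mΩ : MeasurableSpace Ω] (Pr : Measure Ω)
    (ℱ : Filtration ℕ mΩ) (S : ℕ → Ω → State M) (A : ℕ → Ω → Action M Nx) (O : ℕ → Ω → W)
    (Q : ℕ → Ω → QTable M Nx) (G : ℕ → Ω → Action M Nx) : Prop where
  finite_init : (Set.range (S 0)).Finite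
  meas_init : ∀ s, MeasurableSet[ℱ 0] {ω | S 0 ω = s}
  meas_action : ∀ n a, MeasurableSet[ℱ (n + 1)] {ω | A n ω = a}
  meas_outcome : ∀ n w, MeasurableSet[ℱ (n + 1)] {ω | O n ω = w}
  meas_greedy : ∀ n a, MeasurableSet[ℱ n] {ω | G n ω = a}
  greedy : ∀ n ω, IsGreedy (Q n ω) (S n ω) (G n ω)
  /-- given the past, the action is drawn by the `ε`-greedy policy and, independently of it, the
  outcome of the slot is drawn by nature -/
  law : ∀ n a w,
    Pr[Set.indicator {ω | A n ω = a ∧ O n ω = w} (fun _ => (1 : ℝ)) | ℱ n] =ᵐ[Pr]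
      fun ω => epsGreedy ε (G n ω) a * (sys.nature (S n ω).B (S n ω).ρhat w).toReal
  state_succ : ∀ n ω, S (n + 1) ω = sys.nextState (S n ω) (A n ω) (O n ω)
  Q_zero : ∀ ω, Q 0 ω = Q₀
  Q_succ : ∀ n ω, Q (n + 1) ω =
    bellmanUpdate (Q n ω) (α (visits (S · ω) (A · ω) n (S n ω) (A n ω))) γ
      (sys.utility (O n ω) (S n ω).b (A n ω).1 (rate (A n ω)))
      (S n ω) (A n ω) (S (n + 1) ω)

end MEC

end

/-!
Write `κ = f + β ς N f³ + μ N`. Offloading at rate `x` to device `i` gains `x C` bits and saves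
`x C (β ς N f² + μ N / f)` in local energy and delay, that is `x C κ / f` in total, and costs at
least `β P x C / B_i` for the transmission, which is no less because `B_i κ ≤ β P f`. It also drains
the battery at least as much as local computation, so that the drop loss is no smaller
(`Model.utility_add_le`).

The value `V` of always computing locally increases with the battery level, because a run from a
fuller battery with the same outcomes stays at higher levels. So offloading loses in the present
slot and in the future, and `V` solves the Bellman optimality equation
(`Model.exists_optimal_value`). An action as good as local computation in the optimal Q-function
has the same utility in every outcome of positive probability, and so `x = 0` if the condition
is strict.

It remains to prove that Q-learning converges. All processes take finitely many values up to any
given slot, which settles measurability and integrability. The sampling noise in each table entry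
is a martingale difference sequence whose squares are dominated by those of the learning rates, so
its series converges (`IsQLearningRun.ae_exists_tendsto_sum_noise`). Lévy's conditional
Borel–Cantelli lemma shows that in a state visited infinitely often, every action is taken
infinitely often together with every outcome of positive probability
(`IsQLearningRun.ae_frequently_step`). The random set of recurrent states is thus closed under
the dynamics. Along a fixed path, the Q-table restricted to it is an asynchronous iteration of a
`γ`-contraction, with noise whose series converges (`tendsto_zero_of_async_contraction`), and it
converges to the optimal Q-function (`IsQLearningRun.ae_tendsto_Q`). Since only recurrent states
are visited in the long run and there are finitely many of them, the maximizers at the current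
state are eventually maximizers of the limit.
-/

noncomputable section

namespace MEC

open scoped Topology

/-! ### Stochastic approximation along a single path -/

/-- A relaxation `y ↦ (1 - a) y + a g` with step sizes in `[0, 1]` of infinite total forgets its
initial value: `y` ends up, up to any error, within an eventual bound for the targets `g`. -/
theorem eventually_abs_le_of_relaxation {y a g : ℕ → ℝ} {c η : ℝ}
    (ha0 : ∀ n, 0 ≤ a n) (ha1 : ∀ n, a n ≤ 1)
    (hdiv : Tendsto (fun n => ∑ k ∈ Finset.range n, a k) atTop atTop)
    (hy : ∀ n, y (n + 1) = (1 - a n) * y n + a n * g n)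
    (hg : ∀ᶠ n in atTop, |g n| ≤ c) (hη : 0 < η) :
    ∀ᶠ n in atTop, |y n| ≤ c + η := by
  obtain ⟨n₀, hn₀⟩ := eventually_atTop.1 hg
  -- the excess of `|y|` over `c` is multiplied by at most `1 - a n ≤ exp (-a n)` in step `n`
  set z : ℕ → ℝ := fun n => max (|y n| - c) 0 with hz
  have hz0 : ∀ n, 0 ≤ z n := fun n => le_max_right _ _
  have hstep : ∀ n, n₀ ≤ n → z (n + 1) ≤ (1 - a n) * z n := by
    intro n hn
    have h1 : |y (n + 1)| ≤ (1 - a n) * |y n| + a n * c := by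
      rw [hy n]
      refine (abs_add_le _ _).trans ?_
      rw [abs_mul, abs_mul, abs_of_nonneg (ha0 n), abs_of_nonneg (sub_nonneg.2 (ha1 n))]
      gcongr
      · exact ha0 n
      · exact hn₀ n hn
    have h2 : |y n| - c ≤ z n := le_max_left _ _
    refine max_le ?_ (mul_nonneg (sub_nonneg.2 (ha1 n)) (hz0 n))
    nlinarith [mul_le_mul_of_nonneg_left h2 (sub_nonneg.2 (ha1 n))]
  have hexp : ∀ n, n₀ ≤ n → z n ≤
      z n₀ * Real.exp (∑ k ∈ Finset.range n₀, a k - ∑ k ∈ Finset.range n, a k) := by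
    intro n hn
    induction n, hn using Nat.le_induction with
    | base => simp
    | succ n hn ih =>
      have h1 : 1 - a n ≤ Real.exp (-a n) := by linarith [Real.add_one_le_exp (-a n)]
      calc z (n + 1) ≤ (1 - a n) * z n := hstep n hn
        _ ≤ Real.exp (-a n) * (z n₀ *
            Real.exp (∑ k ∈ Finset.range n₀, a k - ∑ k ∈ Finset.range n, a k)) := by
          gcongr
        _ = _ := by
          rw [Finset.sum_range_succ, mul_left_comm, ← Real.exp_add]
          congr 2
          ring
  have hlim : Tendsto (fun n => z n₀ *
      Real.exp (∑ k ∈ Finset.range n₀, a k - ∑ k ∈ Finset.range n, a k)) atTop (𝓝 0) := by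
    have h1 : Tendsto (fun n => ∑ k ∈ Finset.range n₀, a k - ∑ k ∈ Finset.range n, a k)
        atTop atBot := tendsto_atBot_add_const_left _ _ (tendsto_neg_atTop_atBot.comp hdiv)
    simpa using (Real.tendsto_exp_atBot.comp h1).const_mul (z n₀)
  filter_upwards [hlim.eventually (gt_mem_nhds hη), eventually_ge_atTop n₀] with n h1 h2
  have h3 : |y n| - c ≤ z n := le_max_left _ _
  linarith [hexp n h2]

/-- Convergence of an asynchronous, noisy fixed-point iteration, in terms of the errors `e p`: the
coordinate `p` moves with step size `a p n` towards a target whose error `h p n` is at most `γ`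
times the largest current error, and is disturbed by noise `ξ p` whose series converges. -/
theorem tendsto_zero_of_async_contraction {I : Type*} [Finite I] {e a ξ h : I → ℕ → ℝ} {γ : ℝ}
    (hγ0 : 0 ≤ γ) (hγ1 : γ < 1) (ha0 : ∀ p n, 0 ≤ a p n) (ha1 : ∀ p n, a p n ≤ 1)
    (hdiv : ∀ p, Tendsto (fun n => ∑ k ∈ Finset.range n, a p k) atTop atTop)
    (hrec : ∀ p n, e p (n + 1) = (1 - a p n) * e p n + ξ p n + a p n * h p n)
    (hξ : ∀ p, ∃ l, Tendsto (fun n => ∑ k ∈ Finset.range n, ξ p k) atTop (𝓝 l))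
    (hh : ∀ n D, (∀ q, |e q n| ≤ D) → ∀ p, |h p n| ≤ γ * D)
    (hb : ∃ K, ∀ p n, |e p n| ≤ K) (p : I) : Tendsto (e p) atTop (𝓝 0) := by
  obtain ⟨K₀, hK₀⟩ := hb
  set K := max K₀ 1
  have hK : ∀ p n, |e p n| ≤ K := fun p n => (hK₀ p n).trans (le_max_left _ _)
  have hKpos : 0 < K := lt_of_lt_of_le one_pos (le_max_right _ _)
  have hκ0 : 0 < (1 + γ) / 2 := by linarith
  have hκ1 : (1 + γ) / 2 < 1 := by linarith
  have key : ∀ k : ℕ, ∀ᶠ n in atTop, ∀ p, |e p n| ≤ ((1 + γ) / 2) ^ k * K := by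
    intro k
    induction k with
    | zero => exact Eventually.of_forall fun n p => by simpa using hK p n
    | succ k ih =>
      set D := ((1 + γ) / 2) ^ k * K
      have hD : 0 < D := by positivity
      have hη : 0 < (1 - γ) * D / 6 := by
        have : 0 < 1 - γ := by linarith
        positivity
      rw [eventually_all]
      intro p
      obtain ⟨l, hl⟩ := hξ p
      -- adding the tail of the noise series to the error removes the noise from the recursion
      set r : ℕ → ℝ := fun n => l - ∑ k ∈ Finset.range n, ξ p k with hr
      have hr0 : ∀ᶠ n in atTop, |r n| ≤ (1 - γ) * D / 6 := by
        have : Tendsto r atTop (𝓝 0) := by simpa using hl.const_sub l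
        filter_upwards [(this.abs).eventually (gt_mem_nhds (abs_zero.trans_lt hη))] with n hn
        exact hn.le
      have hy : ∀ n, e p (n + 1) + r (n + 1)
          = (1 - a p n) * (e p n + r n) + a p n * (h p n + r n) := by
        intro n
        simp only [hr, hrec, Finset.sum_range_succ]
        ring
      have hg : ∀ᶠ n in atTop, |h p n + r n| ≤ γ * D + (1 - γ) * D / 6 := by
        filter_upwards [ih, hr0] with n h1 h2
        exact (abs_add_le _ _).trans (add_le_add (hh n D h1 p) h2)
      filter_upwards [eventually_abs_le_of_relaxation
        (y := fun n => e p n + r n) (g := fun n => h p n + r n) (ha0 p) (ha1 p) (hdiv p) hy hg hη, hr0]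
        with n h1 h2
      have h3 : |e p n| ≤ |e p n + r n| + |r n| := by
        simpa using abs_sub (e p n + r n) (r n)
      have h4 : ((1 + γ) / 2) ^ (k + 1) * K = (1 + γ) / 2 * D := by
        simp only [D]; ring
      rw [h4]
      nlinarith
  rw [Metric.tendsto_nhds]
  intro δ hδ
  have hlim : Tendsto (fun k : ℕ => ((1 + γ) / 2) ^ k * K) atTop (𝓝 0) := by
    simpa using (tendsto_pow_atTop_nhds_zero_of_lt_one hκ0.le hκ1).mul_const K
  obtain ⟨k, hk⟩ := (hlim.eventually (gt_mem_nhds hδ)).exists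
  filter_upwards [key k] with n hn
  rw [Real.dist_eq, sub_zero]
  exact (hn p).trans_lt hk

/-- A sequence in a finite set eventually takes only values that recur infinitely often. -/
theorem eventually_frequently_eq {T : Type*} {X : Set T} (hX : X.Finite) {u : ℕ → T}
    (hu : ∀ n, u n ∈ X) : ∀ᶠ n in atTop, ∃ᶠ k in atTop, u k = u n := by
  have h1 : ∀ᶠ n in atTop, ∀ s ∈ X, (∃ᶠ k in atTop, u k = s) ∨ u n ≠ s := by
    refine (eventually_all_finite hX).2 fun s _ => ?_
    by_cases hs : ∃ᶠ k in atTop, u k = s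
    · exact Eventually.of_forall fun n => Or.inl hs
    · exact (not_frequently.1 hs).mono fun n hn => Or.inr hn
  filter_upwards [h1] with n hn
  exact (hn _ (hu n)).resolve_right fun hc => hc rfl

/-! ### Random variables with finitely many values -/

section Simple

variable {Ω T T' : Type*}

/-- A random variable with finitely many values and `m`-measurable fibres. Unlike for
`MeasureTheory.SimpleFunc`, this is a predicate, and no structure on the target is needed, so it
applies to states and whole Q-tables. -/
def IsSimpleRV (m : MeasurableSpace Ω) (g : Ω → T) : Prop :=
  (Set.range g).Finite ∧ ∀ t, MeasurableSet[m] {ω | g ω = t}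

namespace IsSimpleRV

variable {m m' : MeasurableSpace Ω} {g : Ω → T} {g' : Ω → T'}

theorem const (t : T) : IsSimpleRV m (fun _ : Ω => t) :=
  ⟨Set.finite_range_const, fun _ => MeasurableSet.const _⟩

theorem of_finite [Finite T] (h : ∀ t, MeasurableSet[m] {ω | g ω = t}) : IsSimpleRV m g :=
  ⟨Set.toFinite _, h⟩

theorem comp (hg : IsSimpleRV m g) (F : T → T') : IsSimpleRV m (fun ω => F (g ω)) := by
  refine ⟨(hg.1.image F).subset ?_, fun t => ?_⟩
  · rintro _ ⟨ω, rfl⟩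
    exact ⟨g ω, ⟨ω, rfl⟩, rfl⟩
  · have : {ω | F (g ω) = t} = ⋃ u ∈ {u ∈ Set.range g | F u = t}, {ω | g ω = u} := by
      ext ω
      simp
    rw [this]
    exact (hg.1.subset fun u hu => hu.1).measurableSet_biUnion fun u _ => hg.2 u

theorem prodMk (hg : IsSimpleRV m g) (hg' : IsSimpleRV m g') :
    IsSimpleRV m (fun ω => (g ω, g' ω)) := by
  refine ⟨(hg.1.prod hg'.1).subset ?_, fun t => ?_⟩
  · rintro _ ⟨ω, rfl⟩
    exact ⟨⟨ω, rfl⟩, ⟨ω, rfl⟩⟩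
  · have : {ω | (g ω, g' ω) = t} = {ω | g ω = t.1} ∩ {ω | g' ω = t.2} := by
      ext ω
      simp [Prod.ext_iff]
    rw [this]
    exact (hg.2 _).inter (hg'.2 _)

theorem mono (hg : IsSimpleRV m g) (h : m ≤ m') : IsSimpleRV m' g :=
  ⟨hg.1, fun t => h _ (hg.2 t)⟩

theorem measurableSet (hg : IsSimpleRV m g) (p : T → Prop) : MeasurableSet[m] {ω | p (g ω)} := by
  have h := (hg.comp p).2 True
  simpa using h

theorem stronglyMeasurable {g : Ω → ℝ} (hg : IsSimpleRV m g) : StronglyMeasurable[m] g :=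
  (⟨g, hg.2, hg.1⟩ : @SimpleFunc Ω m ℝ).stronglyMeasurable

theorem integrable {g : Ω → ℝ} (hg : IsSimpleRV m g) {μ : Measure[m] Ω} [IsFiniteMeasure μ] :
    Integrable g μ :=
  (⟨g, hg.2, hg.1⟩ : @SimpleFunc Ω m ℝ).integrable_of_isFiniteMeasure

theorem finsetSum {g : ℕ → Ω → ℝ} (n : ℕ) (hg : ∀ k < n, IsSimpleRV m (g k)) :
    IsSimpleRV m (fun ω => ∑ k ∈ Finset.range n, g k ω) := by
  induction n with
  | zero => simpa using const (m := m) (0 : ℝ)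
  | succ n ih =>
    simp only [Finset.sum_range_succ]
    exact ((ih fun k hk => hg k (by omega)).prodMk (hg n (by omega))).comp fun x => x.1 + x.2

end IsSimpleRV

variable {mΩ : MeasurableSpace Ω} {Pr : Measure Ω} {ℱ : Filtration ℕ mΩ}

/-- A series of martingale differences with finitely many values converges almost surely if its
squares have bounded sums: its partial sums form a martingale that is bounded in `L²`. -/
theorem ae_exists_tendsto_sum_of_condExp_eq_zero [IsProbabilityMeasure Pr] {ξ : ℕ → Ω → ℝ}
    (hξ : ∀ n, IsSimpleRV (ℱ (n + 1)) (ξ n)) (h0 : ∀ n, Pr[ξ n | ℱ n] =ᵐ[Pr] 0) {c : ℝ}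
    (hc : ∀ n ω, ∑ k ∈ Finset.range n, ξ k ω ^ 2 ≤ c) :
    ∀ᵐ ω ∂Pr, ∃ l, Tendsto (fun n => ∑ k ∈ Finset.range n, ξ k ω) atTop (𝓝 l) := by
  set Z : ℕ → Ω → ℝ := fun n ω => ∑ k ∈ Finset.range n, ξ k ω with hZ
  have hZs : ∀ n, IsSimpleRV (ℱ n) (Z n) := fun n =>
    IsSimpleRV.finsetSum n fun k hk => (hξ k).mono (ℱ.mono hk)
  have hint : ∀ {n} {g : Ω → ℝ}, IsSimpleRV (ℱ n) g → Integrable g Pr :=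
    fun {n} {g} hg => (hg.mono (ℱ.le n)).integrable
  have hmart : Martingale Z ℱ Pr := by
    refine martingale_of_condExp_sub_eq_zero_nat (fun n => (hZs n).stronglyMeasurable)
      (fun n => hint (hZs n)) fun n => ?_
    have : Z (n + 1) - Z n = ξ n := by
      ext ω
      simp [hZ, Finset.sum_range_succ]
    rw [this]
    exact h0 n
  have hcross : ∀ n, ∫ ω, Z n ω * ξ n ω ∂Pr = 0 := by
    intro n
    have hi : Integrable (Z n * ξ n) Pr :=
      hint ((((hZs n).mono (ℱ.mono n.le_succ)).prodMk (hξ n)).comp fun x => x.1 * x.2)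
    have h1 := condExp_mul_of_stronglyMeasurable_left (hZs n).stronglyMeasurable hi (hint (hξ n))
    have h2 : Pr[Z n * ξ n | ℱ n] =ᵐ[Pr] 0 := by
      filter_upwards [h1, h0 n] with ω h1 h2
      rw [h1, Pi.mul_apply, h2]
      simp
    have h3 := integral_condExp (μ := Pr) (f := Z n * ξ n) (ℱ.le n)
    rw [integral_congr_ae h2] at h3
    simpa using h3.symm
  have hsq : ∀ n, ∫ ω, Z n ω ^ 2 ∂Pr = ∫ ω, ∑ k ∈ Finset.range n, ξ k ω ^ 2 ∂Pr := by
    intro n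
    induction n with
    | zero => simp [hZ]
    | succ n ih =>
      have e1 : ∀ ω, Z (n + 1) ω ^ 2 = Z n ω ^ 2 + 2 * (Z n ω * ξ n ω) + ξ n ω ^ 2 := by
        intro ω
        simp only [hZ, Finset.sum_range_succ]
        ring
      have hZ' := (hZs n).mono (ℱ.mono n.le_succ)
      have i1 : Integrable (fun ω => Z n ω ^ 2) Pr := hint (hZ'.comp fun x => x ^ 2)
      have i2 : Integrable (fun ω => 2 * (Z n ω * ξ n ω)) Pr :=
        hint ((hZ'.prodMk (hξ n)).comp fun x => 2 * (x.1 * x.2))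
      have i3 : Integrable (fun ω => ξ n ω ^ 2) Pr := hint ((hξ n).comp fun x => x ^ 2)
      have i4 : Integrable (fun ω => ∑ k ∈ Finset.range n, ξ k ω ^ 2) Pr :=
        integrable_finsetSum _ fun k _ => hint ((hξ k).comp fun x => x ^ 2)
      simp only [e1, Finset.sum_range_succ]
      rw [integral_add (f := fun ω => Z n ω ^ 2 + 2 * (Z n ω * ξ n ω)) (i1.add i2) i3,
        integral_add i1 i2, integral_add i4 i3, ih, integral_const_mul, hcross]
      simp
  have hc0 : ∀ n, ∫ ω, Z n ω ^ 2 ∂Pr ≤ c := by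
    intro n
    rw [hsq n]
    have i4 : Integrable (fun ω => ∑ k ∈ Finset.range n, ξ k ω ^ 2) Pr :=
      integrable_finsetSum _ fun k _ => hint ((hξ k).comp fun x => x ^ 2)
    simpa using integral_mono i4 (integrable_const c) (hc n)
  refine hmart.submartingale.exists_ae_tendsto_of_bdd (R := Real.toNNReal (1 + c)) fun n => ?_
  rw [eLpNorm_one_eq_lintegral_enorm, ← ofReal_integral_norm_eq_lintegral_enorm (hint (hZs n))]
  refine ENNReal.ofReal_le_ofReal ?_
  have i1 : Integrable (fun ω => Z n ω ^ 2) Pr := hint ((hZs n).comp fun x => x ^ 2)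
  calc ∫ ω, ‖Z n ω‖ ∂Pr ≤ ∫ ω, (1 + Z n ω ^ 2) ∂Pr := by
        refine integral_mono (hint (hZs n)).norm ((integrable_const 1).add i1) fun ω => ?_
        rw [Real.norm_eq_abs, ← sq_abs (Z n ω)]
        nlinarith [sq_nonneg (|Z n ω| - 1), abs_nonneg (Z n ω)]
    _ = 1 + ∫ ω, Z n ω ^ 2 ∂Pr := by
        rw [integral_add (integrable_const 1) i1]
        simp
    _ ≤ 1 + c := by linarith [hc0 n]

end Simple

/-! ### Discounted values -/

/-- A stationary policy with transition law `p`, bounded rewards `u` and next states `nx` has a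
discounted value `V`. It inherits every order on the states that the rewards and the next states
respect, being the limit of the finite-horizon values, which do. -/
theorem exists_discounted_value {X W : Type*} [Fintype W] {p : X → W → ℝ} (hp0 : ∀ s w, 0 ≤ p s w)
    (hp1 : ∀ s, ∑ w, p s w = 1) {u : X → W → ℝ} {K : ℝ} (hu : ∀ s w, |u s w| ≤ K)
    (nx : X → W → X) {γ : ℝ} (hγ0 : 0 ≤ γ) (hγ1 : γ < 1) (r : X → X → Prop)
    (hr : ∀ s t, r s t → p s = p t ∧ ∀ w, u s w ≤ u t w ∧ r (nx s w) (nx t w)) :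
    ∃ V : X → ℝ, (∀ s, V s = ∑ w, p s w * (u s w + γ * V (nx s w))) ∧
      ∀ s t, r s t → V s ≤ V t := by
  let T : (X → ℝ) → X → ℝ := fun v s => ∑ w, p s w * (u s w + γ * v (nx s w))
  let v : ℕ → X → ℝ := fun k => T^[k] 0
  have hsucc : ∀ k s, v (k + 1) s = ∑ w, p s w * (u s w + γ * v k (nx s w)) := by
    intro k s
    simp only [v, Function.iterate_succ_apply', T]
  have havg : ∀ s (g : W → ℝ) (D : ℝ), (∀ w, |g w| ≤ D) → |∑ w, p s w * g w| ≤ D := by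
    intro s g D hg
    calc |∑ w, p s w * g w| ≤ ∑ w, |p s w * g w| := Finset.abs_sum_le_sum_abs _ _
      _ ≤ ∑ w, p s w * D := by
        refine Finset.sum_le_sum fun w _ => ?_
        rw [abs_mul, abs_of_nonneg (hp0 s w)]
        exact mul_le_mul_of_nonneg_left (hg w) (hp0 s w)
      _ = D := by rw [← Finset.sum_mul, hp1, one_mul]
  have hdist : ∀ k s, |v (k + 1) s - v k s| ≤ K * γ ^ k := by
    intro k
    induction k with
    | zero =>
      intro s
      have : v 1 s - v 0 s = ∑ w, p s w * u s w := by
        rw [hsucc]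
        simp [v]
      rw [this]
      simpa using havg s _ K (hu s)
    | succ k ih =>
      intro s
      have : v (k + 2) s - v (k + 1) s
          = ∑ w, p s w * (γ * (v (k + 1) (nx s w) - v k (nx s w))) := by
        rw [hsucc (k + 1), hsucc k, ← Finset.sum_sub_distrib]
        exact Finset.sum_congr rfl fun w _ => by ring
      rw [this]
      refine havg s _ _ fun w => ?_
      rw [abs_mul, abs_of_nonneg hγ0, pow_succ]
      calc γ * |v (k + 1) (nx s w) - v k (nx s w)| ≤ γ * (K * γ ^ k) := by
            gcongr
            exact ih _
        _ = _ := by ring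
  have hlim : ∀ s, ∃ l, Tendsto (fun k => v k s) atTop (𝓝 l) := fun s =>
    cauchySeq_tendsto_of_complete <| cauchySeq_of_le_geometric γ K hγ1 fun k => by
      rw [dist_comm, Real.dist_eq]
      exact hdist k s
  choose V hV using hlim
  refine ⟨V, fun s => ?_, fun s t hst => ?_⟩
  · refine tendsto_nhds_unique ((hV s).comp (tendsto_add_atTop_nat 1)) ?_
    simp only [Function.comp_def, hsucc]
    exact tendsto_finsetSum _ fun w _ =>
      (((hV (nx s w)).const_mul γ).const_add (u s w)).const_mul (p s w)
  · have hmono : ∀ k s t, r s t → v k s ≤ v k t := by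
      intro k
      induction k with
      | zero => intro s t _; simp [v]
      | succ k ih =>
        intro s t hst
        obtain ⟨h1, h2⟩ := hr s t hst
        rw [hsucc, hsucc, h1]
        refine Finset.sum_le_sum fun w _ => mul_le_mul_of_nonneg_left ?_ (hp0 t w)
        exact add_le_add (h2 w).1 (mul_le_mul_of_nonneg_left (ih _ _ (h2 w).2) hγ0)
    exact le_of_tendsto_of_tendsto' (hV s) (hV t) fun k => hmono k s t hst

/-! ### The utility of a slot -/

theorem cycleSum_const {n : ℝ} (c : ℝ) : cycleSum n (fun _ => c) = n * c := by
  simp [cycleSum]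
  ring

theorem rate_nonneg {M Nx : ℕ} (a : Action M Nx) : 0 ≤ rate a := by
  unfold rate
  positivity

theorem rate_zero {M Nx : ℕ} (i : Fin M) : rate ((i, 0) : Action M Nx) = 0 := by simp [rate]

namespace Model

variable {M Nx : ℕ} {W : Type*} {sys : Model M W} {f : ℝ}

theorem localEnergy_eq (hfreq : ∀ m, sys.freq m = f) (w : W) (x : ℝ) :
    sys.localEnergy w x = (1 - x) * sys.C w * sys.N * (sys.ς * f ^ 2) := by
  simp only [localEnergy, hfreq, cycleSum_const]

theorem localDelay_eq (hfreq : ∀ m, sys.freq m = f) (w : W) (x : ℝ) :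
    sys.localDelay w x = (1 - x) * sys.C w * sys.N / f := by
  simp only [localDelay, hfreq, cycleSum_const]
  ring

/-- Fully local computation involves no MEC device. -/
theorem nextEnergy_zero (w : W) (b : ℝ) (i j : Fin M) :
    sys.nextEnergy w b i 0 = sys.nextEnergy w b j 0 := by
  simp [nextEnergy, txEnergy]

theorem utility_zero (w : W) (b : ℝ) (i j : Fin M) :
    sys.utility w b i 0 = sys.utility w b j 0 := by
  simp only [utility, nextEnergy_zero w b i j]
  simp [txEnergy, txDelay]

open Classical in
theorem utility_zero_eq (hf : 0 < f) (hfreq : ∀ m, sys.freq m = f) (hN : 0 ≤ sys.N)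
    {w : W} (hC : 0 < sys.C w) (b : ℝ) (i : Fin M) :
    sys.utility w b i 0 =
      - sys.ψ * (if b - sys.ς * sys.C w * sys.N * f ^ 2 + sys.ρ w ≤ 0 then 1 else 0)
        - sys.C w * sys.N * (sys.β * sys.ς * f ^ 2 + sys.μ / f) := by
  have h1 : sys.nextEnergy w b i 0 = b - sys.ς * sys.C w * sys.N * f ^ 2 + sys.ρ w := by
    simp only [nextEnergy, localEnergy_eq hfreq, txEnergy]
    ring
  have h2 : max (sys.localDelay w 0) (sys.txDelay w i 0) = sys.C w * sys.N / f := by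
    rw [localDelay_eq hfreq, txDelay, max_eq_left]
    · ring
    · have : 0 ≤ sys.C w * sys.N / f := by positivity
      simpa using this
  rw [utility, h1, h2, localEnergy_eq hfreq, txEnergy]
  ring

open Classical in
/-- The loss of an action `[i, x]` against fully local computation is at least what the transmission
costs beyond the gain of `x C` bits and the savings in local energy and delay, a difference that
`hcond` makes nonnegative. The energy left in the battery is no higher, either. -/
theorem utility_add_le (hf : 0 < f) (hfreq : ∀ m, sys.freq m = f) (hN : 0 ≤ sys.N)
    (hς : 0 ≤ sys.ς) (hβ : 0 ≤ sys.β) (hμ : 0 ≤ sys.μ) (hψ : 0 ≤ sys.ψ) {w : W}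
    (hC : 0 < sys.C w) {i : Fin M} (hB : 0 < sys.B w i)
    (hcond : sys.B w i * (f + sys.β * sys.ς * sys.N * f ^ 3 + sys.μ * sys.N)
      ≤ sys.β * sys.P w * f) (b : ℝ) (j : Fin M) {x : ℝ} (hx : 0 ≤ x) :
    sys.nextEnergy w b i x ≤ sys.nextEnergy w b j 0 ∧
    sys.utility w b i x + x * sys.C w * ((sys.β * sys.P w * f - sys.B w i *
      (f + sys.β * sys.ς * sys.N * f ^ 3 + sys.μ * sys.N)) / (sys.B w i * f))
      ≤ sys.utility w b j 0 := by
  -- `β = 0` would make the right-hand side of the condition vanish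
  have hβ' : 0 < sys.β := by
    rcases hβ.lt_or_eq with h | h
    · exact h
    · exfalso
      rw [← h] at hcond
      have : 0 < sys.B w i * (f + 0 * sys.ς * sys.N * f ^ 3 + sys.μ * sys.N) := by positivity
      linarith
  have hgap : x * sys.C w * ((sys.β * sys.P w * f - sys.B w i *
      (f + sys.β * sys.ς * sys.N * f ^ 3 + sys.μ * sys.N)) / (sys.B w i * f))
      = sys.β * sys.txEnergy w i x
        - x * sys.C w * (1 + sys.β * sys.ς * sys.N * f ^ 2 + sys.μ * sys.N / f) := by
    rw [txEnergy]
    field_simp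
  have hgap0 : 0 ≤ x * sys.C w * ((sys.β * sys.P w * f - sys.B w i *
      (f + sys.β * sys.ς * sys.N * f ^ 3 + sys.μ * sys.N)) / (sys.B w i * f)) := by
    have := sub_nonneg.2 hcond
    positivity
  have hnext : sys.nextEnergy w b i x ≤ sys.nextEnergy w b j 0 := by
    have h0 : sys.txEnergy w j 0 = 0 := by simp [txEnergy]
    have h1 : 0 ≤ sys.β * (sys.txEnergy w i x - x * sys.C w * sys.ς * sys.N * f ^ 2) := by
      have : 0 ≤ x * sys.C w * (1 + sys.μ * sys.N / f) := by positivity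
      rw [hgap] at hgap0
      linarith
    have h2 := nonneg_of_mul_nonneg_right h1 hβ'
    simp only [nextEnergy, localEnergy_eq hfreq, h0]
    linarith
  refine ⟨hnext, ?_⟩
  rw [hgap, utility_zero_eq hf hfreq hN hC]
  have hb : sys.nextEnergy w b j 0 = b - sys.ς * sys.C w * sys.N * f ^ 2 + sys.ρ w := by
    simp only [nextEnergy, localEnergy_eq hfreq, txEnergy]
    ring
  rw [← hb, utility]
  have hI : sys.ψ * (if sys.nextEnergy w b j 0 ≤ 0 then 1 else 0)
      ≤ sys.ψ * (if sys.nextEnergy w b i x ≤ 0 then 1 else 0) := by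
    refine mul_le_mul_of_nonneg_left ?_ hψ
    split_ifs with h1 h2
    · exact le_rfl
    · exact absurd (hnext.trans h1) h2
    · exact zero_le_one
    · exact le_rfl
  have hT : sys.μ * sys.localDelay w x
      ≤ sys.μ * max (sys.localDelay w x) (sys.txDelay w i x) :=
    mul_le_mul_of_nonneg_left (le_max_left _ _) hμ
  rw [localDelay_eq hfreq] at hT ⊢
  rw [localEnergy_eq hfreq]
  have e1 : sys.μ * ((1 - x) * sys.C w * sys.N / f)
      = sys.C w * sys.N * (sys.μ / f) - x * sys.C w * (sys.μ * sys.N / f) := by ring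
  rw [e1] at hT
  linarith

open Classical in
/-- A fuller battery lowers neither the utility of local computation nor the energy left after it. -/
theorem utility_zero_mono (hψ : 0 ≤ sys.ψ) (w : W) (i : Fin M) {b b' : ℝ} (h : b ≤ b') :
    sys.nextEnergy w b i 0 ≤ sys.nextEnergy w b' i 0 ∧
      sys.utility w b i 0 ≤ sys.utility w b' i 0 := by
  have h1 : sys.nextEnergy w b i 0 ≤ sys.nextEnergy w b' i 0 := by
    simp only [nextEnergy]
    linarith
  refine ⟨h1, ?_⟩
  have hI : sys.ψ * (if sys.nextEnergy w b' i 0 ≤ 0 then 1 else 0)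
      ≤ sys.ψ * (if sys.nextEnergy w b i 0 ≤ 0 then 1 else 0) := by
    refine mul_le_mul_of_nonneg_left ?_ hψ
    split_ifs with h2 h3
    · exact le_rfl
    · exact absurd (h1.trans h2) h3
    · exact zero_le_one
    · exact le_rfl
  simp only [utility]
  linarith

/-- The battery level enters the utility of a slot only through the drop loss. -/
theorem exists_abs_utility_le [Finite W] (sys : Model M W) (i : W → Fin M) (x : W → ℝ) :
    ∃ K, ∀ w b, |sys.utility w b (i w) (x w)| ≤ K := by
  cases nonempty_fintype W
  let r : W → ℝ := fun w => |x w * sys.C w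
    - sys.β * (sys.localEnergy w (x w) + sys.txEnergy w (i w) (x w))
    - sys.μ * max (sys.localDelay w (x w)) (sys.txDelay w (i w) (x w))|
  refine ⟨|sys.ψ| + ∑ w, r w, fun w b => ?_⟩
  have h1 : r w ≤ ∑ w, r w :=
    Finset.single_le_sum (fun w _ => abs_nonneg _) (Finset.mem_univ w)
  have h2 := abs_le.1 (le_refl (r w))
  have h3 := neg_abs_le sys.ψ
  have h4 := le_abs_self sys.ψ
  have h5 := abs_nonneg sys.ψ
  rw [abs_le, utility]
  split_ifs <;> constructor <;> linarith

/-! ### The optimal Q-function -/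

/-- Probability that nature draws the outcome `w` in the state `s`. -/
def prob (sys : Model M W) (s : State M) (w : W) : ℝ := (sys.nature s.B s.ρhat w).toReal

theorem prob_nonneg (s : State M) (w : W) : 0 ≤ sys.prob s w := ENNReal.toReal_nonneg

theorem sum_prob [Fintype W] (s : State M) : ∑ w, sys.prob s w = 1 := by
  have h := (sys.nature s.B s.ρhat).tsum_coe
  rw [tsum_fintype] at h
  simp only [prob]
  rw [← ENNReal.toReal_sum fun w _ => PMF.apply_ne_top _ w, h, ENNReal.toReal_one]

/-- The expected return of the action `a` in the state `s` if the next state `s'` is valued at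
`V s'`: a Q-function as a function of a value function. -/
def lookahead [Fintype W] (sys : Model M W) (γ : ℝ) (V : State M → ℝ) (s : State M)
    (a : Action M Nx) : ℝ :=
  ∑ w, sys.prob s w * (sys.utility w s.b a.1 (rate a) + γ * V (sys.nextState s a w))

/-- The value `V` of local computation solves the Bellman optimality equation, because offloading
gives up utility in the present slot and leaves a lower battery level, and `V` increases with the
battery level. An action that is as good as local computation thus has the same utility in
every outcome of positive probability. -/
theorem exists_optimal_value [Fintype W] (Nx : ℕ) (hψ : 0 ≤ sys.ψ) (hlevel : Monotone sys.level)
    (istar : W → Fin M)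
    (hopt : ∀ w b i x, 0 ≤ x → sys.nextEnergy w b i x ≤ sys.nextEnergy w b (istar w) 0 ∧
      sys.utility w b i x ≤ sys.utility w b (istar w) 0)
    {γ : ℝ} (hγ0 : 0 ≤ γ) (hγ1 : γ < 1) :
    ∃ V : State M → ℝ, (∀ s (i : Fin M), sys.lookahead γ V s ((i, 0) : Action M Nx) = V s) ∧
      (∀ s (a : Action M Nx), sys.lookahead γ V s a ≤ V s) ∧
      ∀ s (a : Action M Nx), sys.lookahead γ V s a = V s → ∀ w, sys.prob s w ≠ 0 →
        sys.utility w s.b a.1 (rate a) = sys.utility w s.b (istar w) 0 := by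
  obtain ⟨K, hK⟩ := sys.exists_abs_utility_le istar (fun _ => 0)
  obtain ⟨V, hV, hmono⟩ := exists_discounted_value (p := sys.prob) prob_nonneg sum_prob
    (u := fun s w => sys.utility w s.b (istar w) 0) (fun s w => hK w s.b)
    (fun s w => ⟨sys.B w, sys.ρhat w, sys.level (sys.nextEnergy w s.b (istar w) 0)⟩) hγ0 hγ1
    (fun s t => s.B = t.B ∧ s.ρhat = t.ρhat ∧ s.b ≤ t.b) (by
      rintro s t ⟨h1, h2, h3⟩
      refine ⟨funext fun w => by rw [prob, prob, h1, h2], fun w => ?_⟩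
      obtain ⟨h4, h5⟩ := utility_zero_mono hψ w (istar w) h3
      exact ⟨h5, rfl, rfl, hlevel h4⟩)
  have hterm : ∀ s (a : Action M Nx) w,
      V (sys.nextState s a w)
        ≤ V ⟨sys.B w, sys.ρhat w, sys.level (sys.nextEnergy w s.b (istar w) 0)⟩ :=
    fun s a w => hmono _ _ ⟨rfl, rfl, hlevel (hopt w s.b a.1 (rate a) (rate_nonneg a)).1⟩
  have hle : ∀ s (a : Action M Nx) w,
      sys.prob s w * (sys.utility w s.b a.1 (rate a) + γ * V (sys.nextState s a w))
      ≤ sys.prob s w * (sys.utility w s.b (istar w) 0 +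
        γ * V ⟨sys.B w, sys.ρhat w, sys.level (sys.nextEnergy w s.b (istar w) 0)⟩) :=
    fun s a w => mul_le_mul_of_nonneg_left (add_le_add
      (hopt w s.b a.1 (rate a) (rate_nonneg a)).2
      (mul_le_mul_of_nonneg_left (hterm s a w) hγ0)) (prob_nonneg s w)
  refine ⟨V, fun s i => ?_, fun s a => ?_, fun s a hsa w hw => ?_⟩
  · rw [hV s, lookahead]
    refine Finset.sum_congr rfl fun w _ => ?_
    rw [nextState, rate_zero, utility_zero w s.b i (istar w), nextEnergy_zero w s.b i (istar w)]
  · rw [hV s]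
    exact Finset.sum_le_sum fun w _ => hle s a w
  · rw [hV s, lookahead] at hsa
    have h1 := (Finset.sum_eq_sum_iff_of_le fun w _ => hle s a w).1 hsa w (Finset.mem_univ w)
    have h2 := mul_left_cancel₀ hw h1
    have h3 := mul_le_mul_of_nonneg_left (hterm s a w) hγ0
    refine le_antisymm (hopt w s.b a.1 (rate a) (rate_nonneg a)).2 ?_
    linarith

end Model

/-! ### Runs of the learning scheme -/

theorem abs_iSup_sub_iSup_le {ι : Type*} [Finite ι] [Nonempty ι] {f g : ι → ℝ} {D : ℝ}
    (h : ∀ i, |f i - g i| ≤ D) : |(⨆ i, f i) - ⨆ i, g i| ≤ D := by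
  have key : ∀ f g : ι → ℝ, (∀ i, |f i - g i| ≤ D) → (⨆ i, f i) ≤ (⨆ i, g i) + D := by
    intro f g h
    refine ciSup_le fun i => ?_
    have h1 := le_ciSup (Set.finite_range g).bddAbove i
    linarith [(abs_le.1 (h i)).2]
  rw [abs_le]
  constructor
  · linarith [key g f fun i => by rw [abs_sub_comm]; exact h i]
  · linarith [key f g h]

section visits

variable {M Nx : ℕ} (S : ℕ → State M) (A : ℕ → Action M Nx)

open Classical in
theorem visits_succ (n : ℕ) (s : State M) (a : Action M Nx) :
    visits S A (n + 1) s a = visits S A n s a + if S n = s ∧ A n = a then 1 else 0 := by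
  simp only [visits, Finset.card_filter, Finset.sum_range_succ]

open Classical in
/-- Summing over the visits to `(s, a)`, slot by slot or by their number. -/
theorem sum_ite_visits (F : ℕ → ℝ) (n : ℕ) (s : State M) (a : Action M Nx) :
    ∑ k ∈ Finset.range n, (if S k = s ∧ A k = a then F (visits S A k s a) else 0)
      = ∑ j ∈ Finset.range (visits S A n s a), F j := by
  induction n with
  | zero => simp [visits]
  | succ n ih =>
    rw [Finset.sum_range_succ, ih, visits_succ]
    split_ifs with h
    · rw [Finset.sum_range_succ]
    · simp

theorem tendsto_visits {s : State M} {a : Action M Nx} (h : ∃ᶠ n in atTop, S n = s ∧ A n = a) :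
    Tendsto (fun n => visits S A n s a) atTop atTop := by
  classical
  have e : ∀ n, visits S A n s a = Nat.count (fun k => S k = s ∧ A k = a) n := by
    intro n
    rw [Nat.count_eq_card_filter_range, visits]
  simp only [e]
  refine tendsto_atTop_atTop_of_monotone (Nat.count_monotone _) fun b => ?_
  exact ⟨_, (Nat.count_nth_of_infinite (Nat.frequently_atTop_iff_infinite.1 h) b).ge⟩

end visits

theorem epsGreedy_pos {M Nx : ℕ} {ε : ℝ} (hε0 : 0 < ε) (hε1 : ε ≤ 1) (g a : Action M Nx) :
    ε / (((Nx : ℝ) + 1) * (M : ℝ)) ≤ epsGreedy ε g a ∧ 0 < ε / (((Nx : ℝ) + 1) * (M : ℝ)) := by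
  have hM : (0 : ℝ) < M := by exact_mod_cast Fin.pos a.1
  refine ⟨?_, by positivity⟩
  rw [epsGreedy]
  split_ifs <;> linarith

namespace IsQLearningRun

variable {M Nx : ℕ} {W : Type*} {sys : Model M W} {α : ℕ → ℝ} {γ ε : ℝ}
  {Q₀ : QTable M Nx} {Ω : Type*} {mΩ : MeasurableSpace Ω} {Pr : Measure Ω}
  {ℱ : Filtration ℕ mΩ} {S : ℕ → Ω → State M} {A : ℕ → Ω → Action M Nx} {O : ℕ → Ω → W}
  {Q : ℕ → Ω → QTable M Nx} {G : ℕ → Ω → Action M Nx}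

section Histories

variable (h : IsQLearningRun sys α γ ε Q₀ Pr ℱ S A O Q G)

include h

theorem isSimpleRV_action (n : ℕ) : IsSimpleRV (ℱ (n + 1)) (A n) :=
  .of_finite (h.meas_action n)

variable [Fintype W]

theorem isSimpleRV_outcome (n : ℕ) : IsSimpleRV (ℱ (n + 1)) (O n) :=
  .of_finite (h.meas_outcome n)

/-- The state, the Q-table and the numbers of visits at the beginning of a slot are known then, and
take finitely many values. -/
theorem isSimpleRV_history (n : ℕ) :
    IsSimpleRV (ℱ n) (fun ω => (S n ω, Q n ω, visits (S · ω) (A · ω) n)) := by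
  classical
  induction n with
  | zero =>
    have h1 : IsSimpleRV (ℱ 0) (S 0) := ⟨h.finite_init, h.meas_init⟩
    convert h1.comp fun s => (s, Q₀, fun (_ : State M) (_ : Action M Nx) => 0) using 4 with ω
    · exact h.Q_zero ω
    · ext s a
      simp [visits]
  | succ n ih =>
    convert ((ih.mono (ℱ.mono n.le_succ)).prodMk
      ((h.isSimpleRV_action n).prodMk (h.isSimpleRV_outcome n))).comp fun x =>
        (sys.nextState x.1.1 x.2.1 x.2.2,
          bellmanUpdate x.1.2.1 (α (x.1.2.2 x.1.1 x.2.1)) γ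
            (sys.utility x.2.2 x.1.1.b x.2.1.1 (rate x.2.1)) x.1.1 x.2.1
            (sys.nextState x.1.1 x.2.1 x.2.2),
          fun s a => x.1.2.2 s a + if x.1.1 = s ∧ x.2.1 = a then 1 else 0) using 4 with ω
    · exact h.state_succ n ω
    · rw [h.Q_succ n ω, h.state_succ n ω]
    · ext s a
      exact visits_succ (S · ω) (A · ω) n s a

theorem isSimpleRV_state (n : ℕ) : IsSimpleRV (ℱ n) (S n) :=
  (h.isSimpleRV_history n).comp fun x => x.1

theorem isSimpleRV_step (n : ℕ) {T : Type*} {F : Ω → Action M Nx → W → T}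
    (hF : IsSimpleRV (ℱ n) F) : IsSimpleRV (ℱ (n + 1)) (fun ω => F ω (A n ω) (O n ω)) :=
  ((hF.mono (ℱ.mono n.le_succ)).prodMk
    ((h.isSimpleRV_action n).prodMk (h.isSimpleRV_outcome n))).comp fun x => x.1 x.2.1 x.2.2

/-- Conditional expectations over the action and the outcome of a slot are finite sums. -/
theorem condExp_step [IsProbabilityMeasure Pr] (n : ℕ) {F : Ω → Action M Nx → W → ℝ}
    (hF : IsSimpleRV (ℱ n) F) :
    Pr[fun ω => F ω (A n ω) (O n ω) | ℱ n] =ᵐ[Pr] fun ω =>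
      ∑ a, ∑ w, F ω a w * (epsGreedy ε (G n ω) a * sys.prob (S n ω) w) := by
  classical
  let I : Action M Nx × W → Ω → ℝ := fun p =>
    Set.indicator {ω | A n ω = p.1 ∧ O n ω = p.2} fun _ => (1 : ℝ)
  let f : Action M Nx × W → Ω → ℝ := fun p ω => F ω p.1 p.2
  have hI : ∀ p, IsSimpleRV (ℱ (n + 1)) (I p) := by
    intro p
    convert ((h.isSimpleRV_action n).prodMk (h.isSimpleRV_outcome n)).comp
      fun x => if x.1 = p.1 ∧ x.2 = p.2 then (1 : ℝ) else 0 using 2 with ω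
    simp [I, Set.indicator]
  have hf : ∀ p, IsSimpleRV (ℱ n) (f p) := fun p => hF.comp fun x => x p.1 p.2
  have hfI : ∀ p, Integrable (f p * I p) Pr := fun p =>
    ((((hf p).mono (ℱ.mono n.le_succ)).prodMk (hI p)).comp
      fun x => x.1 * x.2).mono (ℱ.le _) |>.integrable
  have e : (fun ω => F ω (A n ω) (O n ω)) = ∑ p, f p * I p := by
    ext ω
    rw [Finset.sum_apply, Finset.sum_eq_single (A n ω, O n ω)]
    · simp [f, I]
    · intro p _ hp
      have : ¬ (A n ω = p.1 ∧ O n ω = p.2) := fun hc => hp (Prod.ext hc.1.symm hc.2.symm)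
      simp [I, Set.indicator, this]
    · simp
  rw [e]
  have h1 := condExp_finsetSum (s := Finset.univ) (fun p _ => hfI p) (ℱ n)
  have h2 : ∀ᵐ ω ∂Pr, ∀ p, (Pr[f p * I p | ℱ n]) ω
      = f p ω * (epsGreedy ε (G n ω) p.1 * sys.prob (S n ω) p.2) := by
    rw [ae_all_iff]
    intro p
    filter_upwards [condExp_mul_of_stronglyMeasurable_left (hf p).stronglyMeasurable (hfI p)
      ((hI p).mono (ℱ.le _)).integrable, h.law n p.1 p.2] with ω h3 h4
    rw [h3, Pi.mul_apply, h4]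
    rfl
  filter_upwards [h1, h2] with ω h1 h2
  rw [h1, Finset.sum_apply, Fintype.sum_prod_type]
  exact Finset.sum_congr rfl fun a _ => Finset.sum_congr rfl fun w _ => h2 (a, w)

/-- Outcomes of probability zero almost surely never occur. -/
theorem ae_prob_ne_zero [IsProbabilityMeasure Pr] :
    ∀ᵐ ω ∂Pr, ∀ n, sys.prob (S n ω) (O n ω) ≠ 0 := by
  classical
  rw [ae_all_iff]
  intro n
  let F : Ω → Action M Nx → W → ℝ := fun ω _ w => if sys.prob (S n ω) w = 0 then 1 else 0
  have hF : IsSimpleRV (ℱ n) F :=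
    (h.isSimpleRV_state n).comp fun s _ w => if sys.prob s w = 0 then (1 : ℝ) else 0
  have h1 : Pr[fun ω => F ω (A n ω) (O n ω) | ℱ n] =ᵐ[Pr] 0 := by
    filter_upwards [h.condExp_step n hF] with ω hω
    rw [hω]
    refine Finset.sum_eq_zero fun a _ => Finset.sum_eq_zero fun w _ => ?_
    simp only [F]
    split_ifs with h2
    · simp [h2]
    · simp
  have hi : Integrable (fun ω => F ω (A n ω) (O n ω)) Pr :=
    ((h.isSimpleRV_step n hF).mono (ℱ.le _)).integrable
  have h2 : ∫ ω, F ω (A n ω) (O n ω) ∂Pr = 0 := by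
    rw [← integral_condExp (ℱ.le n), integral_congr_ae h1]
    simp
  have h3 : 0 ≤ fun ω => F ω (A n ω) (O n ω) := fun ω => by
    simp only [F, Pi.zero_apply]
    split_ifs <;> simp
  filter_upwards [(integral_eq_zero_iff_of_nonneg h3 hi).1 h2] with ω hω hp
  simp [F, hp] at hω

/-- By Lévy's conditional Borel–Cantelli lemma, in a state that recurs infinitely often, every
action together with every outcome of positive probability recurs, too: exploration keeps their
conditional probability away from zero. -/
theorem ae_frequently_step [IsProbabilityMeasure Pr] (hε0 : 0 < ε) (hε1 : ε ≤ 1) (s : State M)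
    (a : Action M Nx) {w : W} (hw : sys.prob s w ≠ 0) :
    ∀ᵐ ω ∂Pr, (∃ᶠ n in atTop, S n ω = s) →
      ∃ᶠ n in atTop, S n ω = s ∧ A n ω = a ∧ O n ω = w := by
  classical
  let E : ℕ → Set Ω := fun k =>
    Nat.rec ∅ (fun k _ => {ω | S k ω = s ∧ A k ω = a ∧ O k ω = w}) k
  let F : ℕ → Ω → Action M Nx → W → ℝ := fun n ω a' w' =>
    if S n ω = s ∧ a' = a ∧ w' = w then 1 else 0
  have hF : ∀ n, IsSimpleRV (ℱ n) (F n) := fun n =>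
    (h.isSimpleRV_state n).comp fun t a' w' => if t = s ∧ a' = a ∧ w' = w then (1 : ℝ) else 0
  have hE : ∀ n, MeasurableSet[ℱ n] (E n) := by
    intro n
    cases n with
    | zero => exact @MeasurableSet.empty _ (ℱ 0)
    | succ n =>
      exact (((h.isSimpleRV_state n).mono (ℱ.mono n.le_succ)).prodMk
        ((h.isSimpleRV_action n).prodMk (h.isSimpleRV_outcome n))).measurableSet
        fun x => x.1 = s ∧ x.2.1 = a ∧ x.2.2 = w
  have hind : ∀ n, (E (n + 1)).indicator 1 = fun ω => F n ω (A n ω) (O n ω) := by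
    intro n
    ext ω
    simp [E, F, Set.indicator]
  have hce : ∀ᵐ ω ∂Pr, ∀ n, (Pr[(E (n + 1)).indicator 1 | ℱ n]) ω
      = if S n ω = s then epsGreedy ε (G n ω) a * sys.prob s w else 0 := by
    rw [ae_all_iff]
    intro n
    rw [hind n]
    filter_upwards [h.condExp_step n (hF n)] with ω hω
    rw [hω]
    split_ifs with hs
    · rw [Finset.sum_eq_single a, Finset.sum_eq_single w]
      · simp [F, hs]
      · intro w' _ hw'
        simp [F, hw']
      · simp
      · intro a' _ ha'
        simp [F, ha']
      · simp
    · simp [F, hs]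
  filter_upwards [ae_mem_limsup_atTop_iff Pr hE, hce] with ω hω hce hs
  have hp : 0 < sys.prob s w := (Model.prob_nonneg s w).lt_of_ne' hw
  have hnn : ∀ n, 0 ≤ if S n ω = s then epsGreedy ε (G n ω) a * sys.prob s w else 0 := by
    intro n
    split_ifs
    · have := epsGreedy_pos hε0 hε1 (G n ω) a
      exact mul_nonneg (this.2.le.trans this.1) hp.le
    · exact le_rfl
  have hlim : ω ∈ limsup E atTop := by
    rw [hω]
    simp only [hce]
    rw [← not_summable_iff_tendsto_nat_atTop_of_nonneg hnn]
    intro hsum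
    have hc : 0 < ε / (((Nx : ℝ) + 1) * (M : ℝ)) * sys.prob s w :=
      mul_pos (epsGreedy_pos hε0 hε1 a a).2 hp
    obtain ⟨n, hn1, hn2⟩ :=
      (hs.and_eventually (hsum.tendsto_atTop_zero.eventually (gt_mem_nhds hc))).exists
    rw [if_pos hn1] at hn2
    exact absurd (mul_le_mul_of_nonneg_right (epsGreedy_pos hε0 hε1 (G n ω) a).1 hp.le)
      (not_le.2 hn2)
  rw [mem_limsup_iff_frequently_mem] at hlim
  rw [frequently_atTop] at hlim ⊢
  intro N
  obtain ⟨n, hn, hmem⟩ := hlim (N + 1)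
  obtain ⟨m, rfl⟩ : ∃ m, n = m + 1 := ⟨n - 1, by omega⟩
  exact ⟨m, by omega, hmem⟩

/-- Only finitely many states are reachable. -/
theorem exists_finite_states (hlevels : (Set.range sys.level).Finite) :
    ∃ X : Set (State M), X.Finite ∧ (∀ n ω, S n ω ∈ X) ∧
      ∀ s (a : Action M Nx) w, sys.nextState s a w ∈ X := by
  let Y : Set (State M) :=
    (fun p : W × ℝ => ⟨sys.B p.1, sys.ρhat p.1, p.2⟩) '' (Set.univ ×ˢ Set.range sys.level)
  have hY : ∀ s (a : Action M Nx) w, sys.nextState s a w ∈ Y := fun s a w =>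
    ⟨(w, _), ⟨Set.mem_univ _, Set.mem_range_self _⟩, rfl⟩
  refine ⟨Set.range (S 0) ∪ Y, h.finite_init.union ((Set.finite_univ.prod hlevels).image _),
    fun n ω => ?_, fun s a w => Or.inr (hY s a w)⟩
  cases n with
  | zero => exact Or.inl ⟨ω, rfl⟩
  | succ n => exact Or.inr (h.state_succ n ω ▸ hY _ _ _)

end Histories

end IsQLearningRun

/-! ### Almost sure convergence of the Q-function -/

theorem Model.exists_abs_utility_action_le {M Nx : ℕ} {W : Type*} [Finite W] (sys : Model M W) :
    ∃ K, ∀ w b (a : Action M Nx), |sys.utility w b a.1 (rate a)| ≤ K := by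
  choose K hK using fun a : Action M Nx =>
    sys.exists_abs_utility_le (fun _ => a.1) (fun _ => rate a)
  refine ⟨∑ a, |K a|, fun w b a => (hK a w b).trans ((le_abs_self _).trans ?_)⟩
  exact Finset.single_le_sum (f := fun a => |K a|) (fun a _ => abs_nonneg _) (Finset.mem_univ a)

open Classical in
/-- Step size with which the entry `(s, a)` of the Q-table is updated in slot `n`: the learning
rate, or zero if another entry is updated. -/
def stepSize {M Nx : ℕ} (α : ℕ → ℝ) (S : ℕ → State M) (A : ℕ → Action M Nx) (n : ℕ) (s : State M)
    (a : Action M Nx) : ℝ :=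
  if S n = s ∧ A n = a then α (visits S A n s a) else 0

/-- The value function of a Q-table. -/
def maxValue {M Nx : ℕ} (q : QTable M Nx) (s : State M) : ℝ := ⨆ a, q s a

/-- The noise in the update of the entry `(s, a)`: the deviation of the sampled return from its
expectation given the state and the action, times the step size. -/
def noise {M Nx : ℕ} {W : Type*} [Fintype W] (sys : Model M W) (α : ℕ → ℝ) (γ : ℝ)
    (S : ℕ → State M) (A : ℕ → Action M Nx) (O : ℕ → W) (Q : ℕ → QTable M Nx) (s : State M)
    (a : Action M Nx) (n : ℕ) : ℝ :=
  stepSize α S A n s a *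
    (sys.utility (O n) s.b a.1 (rate a) + γ * maxValue (Q n) (sys.nextState s a (O n))
      - sys.lookahead γ (maxValue (Q n)) s a)

section stepSize

variable {M Nx : ℕ} {α : ℕ → ℝ} {S : ℕ → State M} {A : ℕ → Action M Nx}

theorem stepSize_nonneg (hα : ∀ j, 0 ≤ α j) (n : ℕ) (s : State M) (a : Action M Nx) :
    0 ≤ stepSize α S A n s a := by
  unfold stepSize
  split_ifs
  · exact hα _
  · exact le_rfl

theorem stepSize_le_one (hα : ∀ j, α j ≤ 1) (n : ℕ) (s : State M) (a : Action M Nx) :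
    stepSize α S A n s a ≤ 1 := by
  unfold stepSize
  split_ifs
  · exact hα _
  · exact zero_le_one

open Classical in
theorem sum_stepSize_sq_le (hα : Summable fun j => α j ^ 2) (n : ℕ) (s : State M)
    (a : Action M Nx) :
    ∑ k ∈ Finset.range n, stepSize α S A k s a ^ 2 ≤ ∑' j, α j ^ 2 := by
  have h1 := sum_ite_visits S A (fun j => α j ^ 2) n s a
  have h2 : ∀ k, stepSize α S A k s a ^ 2
      = if S k = s ∧ A k = a then α (visits S A k s a) ^ 2 else 0 := by
    intro k
    unfold stepSize
    split_ifs <;> simp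
  simp only [h2]
  rw [h1]
  exact hα.sum_le_tsum _ fun j _ => sq_nonneg _

theorem tendsto_sum_stepSize (hα0 : ∀ j, 0 ≤ α j) (hα : ¬ Summable α) {s : State M}
    {a : Action M Nx} (h : ∃ᶠ n in atTop, S n = s ∧ A n = a) :
    Tendsto (fun n => ∑ k ∈ Finset.range n, stepSize α S A k s a) atTop atTop := by
  have h1 := fun n => sum_ite_visits S A α n s a
  simp only [stepSize, h1]
  exact ((not_summable_iff_tendsto_nat_atTop_of_nonneg hα0).1 hα).comp (tendsto_visits S A h)

end stepSize

namespace IsQLearningRun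

variable {M Nx : ℕ} {W : Type*} [Fintype W] {sys : Model M W} {α : ℕ → ℝ} {γ ε : ℝ}
  {Q₀ : QTable M Nx} {Ω : Type*} {mΩ : MeasurableSpace Ω} {Pr : Measure Ω}
  {ℱ : Filtration ℕ mΩ} {S : ℕ → Ω → State M} {A : ℕ → Ω → Action M Nx} {O : ℕ → Ω → W}
  {Q : ℕ → Ω → QTable M Nx} {G : ℕ → Ω → Action M Nx}

section Paths

variable (h : IsQLearningRun sys α γ ε Q₀ Pr ℱ S A O Q G)

include h

/-- The Q-values stay bounded, because the utilities are and future returns are discounted. -/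
theorem exists_abs_Q_le (hα : ∀ j, 0 ≤ α j ∧ α j ≤ 1) (hγ0 : 0 ≤ γ) (hγ1 : γ < 1)
    {X : Set (State M)} (hX : X.Finite) (hnext : ∀ s (a : Action M Nx) w, sys.nextState s a w ∈ X) :
    ∃ K, ∀ n ω, ∀ s ∈ X, ∀ a, |Q n ω s a| ≤ K := by
  obtain ⟨U, hU⟩ := sys.exists_abs_utility_action_le (Nx := Nx)
  obtain ⟨K₀, hK₀⟩ := ((hX.prod (Set.finite_univ (α := Action M Nx))).image
    fun p => |Q₀ p.1 p.2|).bddAbove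
  have h1γ : 0 < 1 - γ := by linarith
  set K := max (max K₀ 0) (U / (1 - γ)) with hK
  have hKU : U + γ * K ≤ K := by
    have : U / (1 - γ) ≤ K := le_max_right _ _
    rw [div_le_iff₀ h1γ] at this
    linarith
  have hK0 : 0 ≤ K := (le_max_right K₀ 0).trans (le_max_left _ _)
  refine ⟨K, fun n ω => ?_⟩
  induction n with
  | zero =>
    intro s hs a
    rw [h.Q_zero ω]
    exact (hK₀ ⟨(s, a), ⟨hs, Set.mem_univ a⟩, rfl⟩).trans
      ((le_max_left K₀ 0).trans (le_max_left _ _))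
  | succ n ih =>
    intro s hs a
    rw [h.Q_succ n ω, bellmanUpdate]
    split_ifs with hsa
    · obtain ⟨rfl, rfl⟩ := hsa
      set r := α (visits (S · ω) (A · ω) n (S n ω) (A n ω)) with hr
      have hr0 : 0 ≤ r := (hα _).1
      have hr1 : r ≤ 1 := (hα _).2
      have : Nonempty (Action M Nx) := ⟨A n ω⟩
      have hmax : |⨆ a', Q n ω (S (n + 1) ω) a'| ≤ K := by
        have := abs_iSup_sub_iSup_le (f := fun a' => Q n ω (S (n + 1) ω) a') (g := fun _ => 0)
          (D := K) fun a' => by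
            rw [sub_zero]
            exact ih _ (h.state_succ n ω ▸ hnext _ _ _) a'
        simpa using this
      have hq := abs_le.1 (ih (S n ω) hs (A n ω))
      have hu := abs_le.1 (hU (O n ω) (S n ω).b (A n ω))
      have hm := abs_le.1 hmax
      have ht : |sys.utility (O n ω) (S n ω).b (A n ω).1 (rate (A n ω))
          + γ * ⨆ a', Q n ω (S (n + 1) ω) a'| ≤ K := by
        have h1 := mul_le_mul_of_nonneg_left hm.1 hγ0
        have h2 := mul_le_mul_of_nonneg_left hm.2 hγ0
        rw [abs_le]
        constructor <;> linarith
      have ht := abs_le.1 ht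
      have h1 := mul_le_mul_of_nonneg_left ht.1 hr0
      have h2 := mul_le_mul_of_nonneg_left ht.2 hr0
      have h3 := mul_le_mul_of_nonneg_left hq.1 (sub_nonneg.2 hr1)
      have h4 := mul_le_mul_of_nonneg_left hq.2 (sub_nonneg.2 hr1)
      rw [abs_le]
      constructor <;> linarith
    · exact ih s hs a

/-- A step of Q-learning, as a noisy relaxation towards the expected target. -/
theorem Q_succ_sub (n : ℕ) (ω : Ω) (s : State M) (a : Action M Nx) (c : ℝ) :
    Q (n + 1) ω s a - c = (1 - stepSize α (S · ω) (A · ω) n s a) * (Q n ω s a - c)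
      + noise sys α γ (S · ω) (A · ω) (O · ω) (Q · ω) s a n
      + stepSize α (S · ω) (A · ω) n s a * (sys.lookahead γ (maxValue (Q n ω)) s a - c) := by
  rw [h.Q_succ n ω, bellmanUpdate, noise]
  by_cases hsa : S n ω = s ∧ A n ω = a
  · obtain ⟨rfl, rfl⟩ := hsa
    simp only [stepSize, and_self, if_true, h.state_succ n ω, maxValue]
    ring
  · have hsa' : ¬ (s = S n ω ∧ a = A n ω) := fun hc => hsa ⟨hc.1.symm, hc.2.symm⟩
    simp [stepSize, hsa, hsa']

/-- The noise in each entry sums to a finite limit: it is a martingale difference sequence, and its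
squares are controlled by the squares of the learning rates. -/
theorem ae_exists_tendsto_sum_noise [IsProbabilityMeasure Pr] (hα : ∀ j, 0 ≤ α j ∧ α j ≤ 1)
    (hα2 : Summable fun j => α j ^ 2) (hγ0 : 0 ≤ γ) (hγ1 : γ < 1)
    {X : Set (State M)} (hX : X.Finite) (hnext : ∀ s (a : Action M Nx) w, sys.nextState s a w ∈ X)
    (s : State M) (a : Action M Nx) :
    ∀ᵐ ω ∂Pr, ∃ l, Tendsto (fun n => ∑ k ∈ Finset.range n,
      noise sys α γ (S · ω) (A · ω) (O · ω) (Q · ω) s a k) atTop (𝓝 l) := by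
  classical
  obtain ⟨U, hU⟩ := sys.exists_abs_utility_action_le (Nx := Nx)
  obtain ⟨K, hK⟩ := h.exists_abs_Q_le hα hγ0 hγ1 hX hnext
  have : Nonempty (Action M Nx) := ⟨a⟩
  let t : QTable M Nx → W → ℝ := fun q w =>
    sys.utility w s.b a.1 (rate a) + γ * maxValue q (sys.nextState s a w)
  have ht : ∀ n ω w, |t (Q n ω) w| ≤ U + γ * K := by
    intro n ω w
    refine (abs_add_le _ _).trans (add_le_add (hU _ _ _) ?_)
    rw [abs_mul, abs_of_nonneg hγ0]
    refine mul_le_mul_of_nonneg_left ?_ hγ0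
    have := abs_iSup_sub_iSup_le (f := fun a' => Q n ω (sys.nextState s a w) a')
      (g := fun _ => 0) (D := K) fun a' => by
        rw [sub_zero]
        exact hK n ω _ (hnext _ _ _) a'
    simpa [maxValue] using this
  have hlook : ∀ q, sys.lookahead γ (maxValue q) s a = ∑ w, sys.prob s w * t q w := fun q => rfl
  have hL : ∀ n ω, |sys.lookahead γ (maxValue (Q n ω)) s a| ≤ U + γ * K := by
    intro n ω
    rw [hlook]
    calc |∑ w, sys.prob s w * t (Q n ω) w| ≤ ∑ w, |sys.prob s w * t (Q n ω) w| :=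
          Finset.abs_sum_le_sum_abs _ _
      _ ≤ ∑ w, sys.prob s w * (U + γ * K) := by
        refine Finset.sum_le_sum fun w _ => ?_
        rw [abs_mul, abs_of_nonneg (Model.prob_nonneg s w)]
        exact mul_le_mul_of_nonneg_left (ht n ω w) (Model.prob_nonneg s w)
      _ = U + γ * K := by rw [← Finset.sum_mul, Model.sum_prob, one_mul]
  let Φ : State M × QTable M Nx × (State M → Action M Nx → ℕ) → Action M Nx → W → ℝ :=
    fun x a' w => if x.1 = s ∧ a' = a then
      α (x.2.2 s a) * (t x.2.1 w - sys.lookahead γ (maxValue x.2.1) s a) else 0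
  have hF := fun n => (h.isSimpleRV_history n).comp Φ
  have hnoise : ∀ n, (fun ω => noise sys α γ (S · ω) (A · ω) (O · ω) (Q · ω) s a n)
      = fun ω => Φ (S n ω, Q n ω, visits (S · ω) (A · ω) n) (A n ω) (O n ω) := by
    intro n
    ext ω
    simp only [noise, stepSize, Φ, t]
    split_ifs <;> simp
  refine ae_exists_tendsto_sum_of_condExp_eq_zero (ℱ := ℱ)
    (c := (2 * (U + γ * K)) ^ 2 * ∑' j, α j ^ 2)
    (ξ := fun n ω => noise sys α γ (S · ω) (A · ω) (O · ω) (Q · ω) s a n) (fun n => ?_)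
    (fun n => ?_) fun n ω => ?_
  · rw [hnoise n]
    exact h.isSimpleRV_step n (hF n)
  · rw [hnoise n]
    filter_upwards [h.condExp_step n (hF n)] with ω hω
    rw [hω, Pi.zero_apply]
    refine Finset.sum_eq_zero fun a' _ => ?_
    by_cases hs : S n ω = s ∧ a' = a
    · obtain ⟨hs, rfl⟩ := hs
      have : ∀ w, Φ (S n ω, Q n ω, visits (S · ω) (A · ω) n) a' w
          * (epsGreedy ε (G n ω) a' * sys.prob (S n ω) w)
          = α (visits (S · ω) (A · ω) n s a') * epsGreedy ε (G n ω) a' *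
            (sys.prob s w * t (Q n ω) w
              - sys.prob s w * sys.lookahead γ (maxValue (Q n ω)) s a') := by
        intro w
        simp only [Φ, hs, and_self, if_true]
        ring
      simp only [this]
      rw [← Finset.mul_sum, Finset.sum_sub_distrib, ← Finset.sum_mul, Model.sum_prob, ← hlook]
      ring
    · exact Finset.sum_eq_zero fun w _ => by simp [Φ, hs]
  · calc ∑ k ∈ Finset.range n, noise sys α γ (S · ω) (A · ω) (O · ω) (Q · ω) s a k ^ 2
        ≤ ∑ k ∈ Finset.range n,
          (2 * (U + γ * K)) ^ 2 * stepSize α (S · ω) (A · ω) k s a ^ 2 := by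
          refine Finset.sum_le_sum fun k _ => ?_
          rw [noise, mul_pow, mul_comm]
          refine mul_le_mul_of_nonneg_right (sq_le_sq' ?_ ?_) (sq_nonneg _)
          · linarith [(abs_le.1 (ht k ω (O k ω))).1, (abs_le.1 (hL k ω)).2]
          · linarith [(abs_le.1 (ht k ω (O k ω))).2, (abs_le.1 (hL k ω)).1]
      _ ≤ _ := by
          rw [← Finset.mul_sum]
          exact mul_le_mul_of_nonneg_left (sum_stepSize_sq_le hα2 n s a) (sq_nonneg _)

/-- Almost surely, the Q-values at the states that recur infinitely often converge to the optimal
ones. The recurrent states depend on the path; they are closed under all actions and all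
outcomes of positive probability, so that the iteration restricted to them is a contraction. -/
theorem ae_tendsto_Q [IsProbabilityMeasure Pr] (hα : ∀ j, 0 ≤ α j ∧ α j ≤ 1)
    (hα1 : ¬ Summable α) (hα2 : Summable fun j => α j ^ 2) (hγ0 : 0 ≤ γ) (hγ1 : γ < 1)
    (hε0 : 0 < ε) (hε1 : ε ≤ 1) {X : Set (State M)} (hX : X.Finite) (hSX : ∀ n ω, S n ω ∈ X)
    (hnext : ∀ s (a : Action M Nx) w, sys.nextState s a w ∈ X) {V : State M → ℝ}
    (hV : ∀ s, ⨆ a : Action M Nx, sys.lookahead γ V s a = V s) :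
    ∀ᵐ ω ∂Pr, ∀ s, (∃ᶠ n in atTop, S n ω = s) → ∀ a,
      Tendsto (fun n => Q n ω s a) atTop (𝓝 (sys.lookahead γ V s a)) := by
  obtain ⟨K, hK⟩ := h.exists_abs_Q_le hα hγ0 hγ1 hX hnext
  have h1 : ∀ᵐ ω ∂Pr, ∀ s ∈ X, ∀ (a : Action M Nx) (w : W), sys.prob s w ≠ 0 →
      (∃ᶠ n in atTop, S n ω = s) → ∃ᶠ n in atTop, S n ω = s ∧ A n ω = a ∧ O n ω = w := by
    refine (ae_ball_iff hX.countable).2 fun s _ => ae_all_iff.2 fun a => ae_all_iff.2 fun w => ?_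
    by_cases hw : sys.prob s w = 0
    · exact Eventually.of_forall fun ω hc => absurd hw hc
    · filter_upwards [h.ae_frequently_step hε0 hε1 s a hw] with ω hω _
      exact hω
  have h2 : ∀ᵐ ω ∂Pr, ∀ s ∈ X, ∀ a, ∃ l, Tendsto (fun n => ∑ k ∈ Finset.range n,
      noise sys α γ (S · ω) (A · ω) (O · ω) (Q · ω) s a k) atTop (𝓝 l) :=
    (ae_ball_iff hX.countable).2 fun s _ => ae_all_iff.2 fun a =>
      h.ae_exists_tendsto_sum_noise hα hα2 hγ0 hγ1 hX hnext s a
  filter_upwards [h1, h2] with ω h1 h2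
  have hrec : ∀ {s}, (∃ᶠ n in atTop, S n ω = s) → s ∈ X := fun hs => by
    obtain ⟨n, rfl⟩ := hs.exists
    exact hSX n ω
  have hw : ∀ s : State M, ∃ w, sys.prob s w ≠ 0 := by
    intro s
    by_contra! hc
    have := sys.sum_prob s
    simp [hc] at this
  let R := {s // ∃ᶠ n in atTop, S n ω = s}
  have : Finite R := (hX.subset fun s hs => hrec hs).to_subtype
  have key := tendsto_zero_of_async_contraction (I := R × Action M Nx) (γ := γ)
    (e := fun p n => Q n ω p.1 p.2 - sys.lookahead γ V p.1 p.2)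
    (a := fun p n => stepSize α (S · ω) (A · ω) n p.1 p.2)
    (ξ := fun p n => noise sys α γ (S · ω) (A · ω) (O · ω) (Q · ω) p.1 p.2 n)
    (h := fun p n => sys.lookahead γ (maxValue (Q n ω)) p.1 p.2 - sys.lookahead γ V p.1 p.2)
    hγ0 hγ1 (fun p n => stepSize_nonneg (fun j => (hα j).1) n _ _)
    (fun p n => stepSize_le_one (fun j => (hα j).2) n _ _)
    (fun p => by
      obtain ⟨w, hw⟩ := hw p.1
      exact tendsto_sum_stepSize (fun j => (hα j).1) hα1
        ((h1 p.1 (hrec p.1.2) p.2 w hw p.1.2).mono fun n hn => ⟨hn.1, hn.2.1⟩))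
    (fun p n => h.Q_succ_sub n ω p.1 p.2 _)
    (fun p => h2 p.1 (hrec p.1.2) p.2)
    (by
      intro n D hD p
      have : Nonempty (Action M Nx) := ⟨p.2⟩
      have e1 : sys.lookahead γ (maxValue (Q n ω)) p.1 p.2 - sys.lookahead γ V p.1 p.2
          = ∑ w, sys.prob p.1 w * (γ * (maxValue (Q n ω) (sys.nextState p.1 p.2 w)
            - V (sys.nextState p.1 p.2 w))) := by
        rw [Model.lookahead, Model.lookahead, ← Finset.sum_sub_distrib]
        exact Finset.sum_congr rfl fun w _ => by ring
      rw [e1]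
      calc |∑ w, sys.prob p.1 w * (γ * (maxValue (Q n ω) (sys.nextState p.1 p.2 w)
            - V (sys.nextState p.1 p.2 w)))|
          ≤ ∑ w, |sys.prob p.1 w * (γ * (maxValue (Q n ω) (sys.nextState p.1 p.2 w)
            - V (sys.nextState p.1 p.2 w)))| := Finset.abs_sum_le_sum_abs _ _
        _ ≤ ∑ w, sys.prob p.1 w * (γ * D) := by
          refine Finset.sum_le_sum fun w _ => ?_
          by_cases hw : sys.prob p.1 w = 0
          · simp [hw]
          have hnx : ∃ᶠ n in atTop, S n ω = sys.nextState p.1 p.2 w := by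
            have h3 := h1 p.1 (hrec p.1.2) p.2 w hw p.1.2
            rw [frequently_atTop] at h3 ⊢
            intro m
            obtain ⟨k, hk, hk1, hk2, hk3⟩ := h3 m
            exact ⟨k + 1, by omega, by rw [h.state_succ, hk1, hk2, hk3]⟩
          rw [abs_mul, abs_of_nonneg (Model.prob_nonneg _ _), abs_mul, abs_of_nonneg hγ0,
            ← hV (sys.nextState p.1 p.2 w)]
          refine mul_le_mul_of_nonneg_left (mul_le_mul_of_nonneg_left ?_ hγ0)
            (Model.prob_nonneg _ _)
          exact abs_iSup_sub_iSup_le fun a' => hD (⟨_, hnx⟩, a')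
        _ = γ * D := by rw [← Finset.sum_mul, Model.sum_prob, one_mul])
    (by
      obtain ⟨L, hL⟩ := (Set.finite_range fun p : R × Action M Nx =>
        |sys.lookahead γ V p.1 p.2|).bddAbove
      refine ⟨K + L, fun p n => (abs_sub _ _).trans (add_le_add ?_ (hL ⟨p, rfl⟩))⟩
      exact hK n ω _ (hrec p.1.2) _)
  intro s hs a
  exact tendsto_sub_nhds_zero_iff.1 (key (⟨s, hs⟩, a))

end Paths

end IsQLearningRun

end MEC

end

/-! ### Local computation is optimal and learned -/

open Classical in
theorem theorem2 {M Nx : ℕ} (hNx : 0 < Nx) {W : Type*} [Fintype W]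
    (sys : MEC.Model M W) (f : ℝ) (istar : W → Fin M)
    -- ranges of the physical parameters and weights
    (hf : 0 < f) (hfreq : ∀ m, sys.freq m = f)
    (hN : 0 ≤ sys.N) (hς : 0 ≤ sys.ς) (hβ : 0 ≤ sys.β) (hμ : 0 ≤ sys.μ) (hψ : 0 ≤ sys.ψ)
    (hC : ∀ w, 0 < sys.C w) (hB : ∀ w i, 0 < sys.B w i)
    -- finitely many feasible battery levels
    (hlevel : Monotone sys.level) (hlevels : (Set.range sys.level).Finite)
    -- `istar w` is the device with the largest bandwidth, and the condition of the theorem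
    (histar : ∀ w i, sys.B w i ≤ sys.B w (istar w))
    (hcond : ∀ w, sys.B w (istar w) * (f + sys.β * sys.ς * sys.N * f ^ 3 + sys.μ * sys.N)
      ≤ sys.β * sys.P w * f) :
    -- `[i*, 0]` maximizes the utility of the slot, and its utility
    (∀ (w : W) (b : ℝ),
      (∀ (i : Fin M) (x : ℝ), 0 ≤ x → x ≤ 1 →
        sys.utility w b i x ≤ sys.utility w b (istar w) 0) ∧
      sys.utility w b (istar w) 0 =
        - sys.ψ * (if b - sys.ς * sys.C w * sys.N * f ^ 2 + sys.ρ w ≤ 0 then 1 else 0)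
          - sys.C w * sys.N * (sys.β * sys.ς * f ^ 2 + sys.μ / f)) ∧
    -- the learning scheme attains it with probability 1
    (∀ (α : ℕ → ℝ) (γ ε : ℝ) (Q₀ : MEC.QTable M Nx),
      (∀ j, 0 ≤ α j ∧ α j ≤ 1) → ¬ Summable α → Summable (fun j => α j ^ 2) →
      0 ≤ γ → γ < 1 → 0 < ε → ε ≤ 1 →
      ∀ {Ω : Type*} [mΩ : MeasurableSpace Ω] (Pr : Measure Ω) [IsProbabilityMeasure Pr]
        (ℱ : Filtration ℕ mΩ) (S : ℕ → Ω → MEC.State M) (A : ℕ → Ω → MEC.Action M Nx)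
        (O : ℕ → Ω → W) (Q : ℕ → Ω → MEC.QTable M Nx) (G : ℕ → Ω → MEC.Action M Nx),
        MEC.IsQLearningRun sys α γ ε Q₀ Pr ℱ S A O Q G →
        ∀ᵐ ω ∂Pr,
          -- `[i*, 0]` becomes a maximizer of the Q-function, up to any given error
          (∀ δ : ℝ, 0 < δ → ∀ᶠ n in atTop, ∀ a : MEC.Action M Nx,
            Q n ω (S n ω) a ≤ Q n ω (S n ω) (istar (O n ω), 0) + δ) ∧
          -- eventually every greedy action is optimal and has the utility of `[i*, 0]`
          (∀ᶠ n in atTop, ∀ a : MEC.Action M Nx, MEC.IsGreedy (Q n ω) (S n ω) a →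
            sys.utility (O n ω) (S n ω).b a.1 (MEC.rate a) =
              - sys.ψ * (if (S n ω).b - sys.ς * sys.C (O n ω) * sys.N * f ^ 2 + sys.ρ (O n ω) ≤ 0
                  then 1 else 0)
                - sys.C (O n ω) * sys.N * (sys.β * sys.ς * f ^ 2 + sys.μ / f)) ∧
          -- eventually every greedy action is fully local, unless the condition is an equality
          ((∀ w, sys.B w (istar w) * (f + sys.β * sys.ς * sys.N * f ^ 3 + sys.μ * sys.N)
              < sys.β * sys.P w * f) →
            ∀ᶠ n in atTop, ∀ a : MEC.Action M Nx, MEC.IsGreedy (Q n ω) (S n ω) a →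
              MEC.rate a = 0)) := by
  -- the condition for the largest bandwidth gives it for every device
  have hcond' : ∀ w i, sys.B w i * (f + sys.β * sys.ς * sys.N * f ^ 3 + sys.μ * sys.N)
      ≤ sys.β * sys.P w * f := fun w i =>
    (mul_le_mul_of_nonneg_right (histar w i) (by positivity)).trans (hcond w)
  have hopt : ∀ w b i x, 0 ≤ x →
      sys.nextEnergy w b i x ≤ sys.nextEnergy w b (istar w) 0 ∧
      sys.utility w b i x ≤ sys.utility w b (istar w) 0 := by
    intro w b i x hx
    obtain ⟨h1, h2⟩ := MEC.Model.utility_add_le hf hfreq hN hς hβ hμ hψ (hC w) (hB w i)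
      (hcond' w i) b (istar w) hx
    refine ⟨h1, le_trans (le_add_of_nonneg_right ?_) h2⟩
    have h3 := sub_nonneg.2 (hcond' w i)
    have h4 := hB w i
    have h5 := hC w
    positivity
  refine ⟨fun w b => ⟨fun i x hx _ => (hopt w b i x hx).2,
    MEC.Model.utility_zero_eq hf hfreq hN (hC w) b _⟩, ?_⟩
  intro α γ ε Q₀ hα hα1 hα2 hγ0 hγ1 hε0 hε1 Ω mΩ Pr _ ℱ S A O Q G h
  obtain ⟨V, hV0, hVle, hVeq⟩ :=
    MEC.Model.exists_optimal_value Nx hψ hlevel istar hopt hγ0 hγ1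
  obtain ⟨X, hX, hSX, hnext⟩ := h.exists_finite_states hlevels
  obtain ⟨ω₀⟩ : Nonempty Ω := nonempty_of_isProbabilityMeasure Pr
  have : Nonempty (MEC.Action M Nx) := ⟨A 0 ω₀⟩
  have hV : ∀ s, ⨆ a : MEC.Action M Nx, sys.lookahead γ V s a = V s := fun s =>
    le_antisymm (ciSup_le (hVle s)) ((hV0 s (A 0 ω₀).1).ge.trans
      (le_ciSup (f := fun a : MEC.Action M Nx => sys.lookahead γ V s a)
        (Set.finite_range _).bddAbove ((A 0 ω₀).1, 0)))
  filter_upwards [h.ae_tendsto_Q hα hα1 hα2 hγ0 hγ1 hε0 hε1 hX hSX hnext hV, h.ae_prob_ne_zero]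
    with ω hQ hO
  have hrec := MEC.eventually_frequently_eq hX fun n => hSX n ω
  -- at recurrent states, the Q-table is eventually close to its limit, uniformly
  have hclose : ∀ δ : ℝ, 0 < δ → ∀ᶠ n in atTop, ∀ a : MEC.Action M Nx,
      |Q n ω (S n ω) a - sys.lookahead γ V (S n ω) a| < δ := by
    intro δ hδ
    have h1 : ∀ᶠ n in atTop, ∀ s ∈ X, ∀ a : MEC.Action M Nx, (∃ᶠ k in atTop, S k ω = s) →
        |Q n ω s a - sys.lookahead γ V s a| < δ := by
      refine (eventually_all_finite hX).2 fun s _ => eventually_all.2 fun a => ?_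
      by_cases hs : ∃ᶠ k in atTop, S k ω = s
      · filter_upwards [Metric.tendsto_nhds.1 (hQ s hs a) δ hδ] with n hn _
        exact hn
      · exact Eventually.of_forall fun n hc => absurd hc hs
    filter_upwards [h1, hrec] with n h1 h2 a
    exact h1 _ (hSX n ω) a h2
  have hgreedy : ∀ᶠ n in atTop, ∀ a : MEC.Action M Nx, MEC.IsGreedy (Q n ω) (S n ω) a →
      sys.utility (O n ω) (S n ω).b a.1 (MEC.rate a)
        = sys.utility (O n ω) (S n ω).b (istar (O n ω)) 0 := by
    -- the smallest positive loss in the limiting Q-function separates suboptimal actions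
    obtain ⟨δ, hδ, hgap⟩ : ∃ δ : ℝ, 0 < δ ∧ ∀ s ∈ X, ∀ a : MEC.Action M Nx,
        sys.lookahead γ V s a ≠ V s → δ ≤ V s - sys.lookahead γ V s a := by
      have h1 : ∀ᶠ δ in nhdsWithin (0 : ℝ) (Set.Ioi 0), ∀ s ∈ X, ∀ a : MEC.Action M Nx,
          sys.lookahead γ V s a ≠ V s → δ ≤ V s - sys.lookahead γ V s a := by
        refine (eventually_all_finite hX).2 fun s _ => eventually_all.2 fun a => ?_
        by_cases hs : sys.lookahead γ V s a = V s
        · exact Eventually.of_forall fun δ hc => absurd hs hc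
        · have h2 : 0 < V s - sys.lookahead γ V s a :=
            sub_pos.2 (lt_of_le_of_ne (hVle s a) hs)
          filter_upwards [nhdsWithin_le_nhds (gt_mem_nhds h2)] with δ hδ _
          exact le_of_lt hδ
      obtain ⟨δ, h2, h3⟩ := (h1.and self_mem_nhdsWithin).exists
      exact ⟨δ, h3, h2⟩
    filter_upwards [hclose (δ / 2) (by positivity)] with n hn a ha
    refine hVeq (S n ω) a ?_ (O n ω) (hO n)
    by_contra hne
    have h1 := hgap _ (hSX n ω) a hne
    have h2 := abs_lt.1 (hn a)
    have h3 := abs_lt.1 (hn (a.1, 0))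
    rw [hV0] at h3
    linarith [ha (a.1, 0), h2.2, h3.1]
  refine ⟨fun δ hδ => ?_, ?_, fun hstrict => ?_⟩
  · filter_upwards [hclose (δ / 2) (by positivity)] with n hn a
    have h2 := abs_lt.1 (hn a)
    have h3 := abs_lt.1 (hn (istar (O n ω), 0))
    rw [hV0] at h3
    linarith [hVle (S n ω) a, h2.2, h3.1]
  · filter_upwards [hgreedy] with n hn a ha
    rw [hn a ha, MEC.Model.utility_zero_eq hf hfreq hN (hC _)]
  · filter_upwards [hgreedy] with n hn a ha
    by_contra hne
    have hpos : 0 < MEC.rate a := (MEC.rate_nonneg a).lt_of_ne' hne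
    have h1 := (MEC.Model.utility_add_le hf hfreq hN hς hβ hμ hψ (hC (O n ω)) (hB _ a.1)
      (hcond' _ a.1) (S n ω).b (istar (O n ω)) hpos.le).2
    rw [hn a ha] at h1
    have h2 : sys.B (O n ω) a.1 * (f + sys.β * sys.ς * sys.N * f ^ 3 + sys.μ * sys.N)
        < sys.β * sys.P (O n ω) * f :=
      (mul_le_mul_of_nonneg_right (histar _ a.1) (by positivity)).trans_lt (hstrict _)
    have h3 := mul_pos (mul_pos hpos (hC (O n ω)))
      (div_pos (sub_pos.2 h2) (mul_pos (hB (O n ω) a.1) hf))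
    linarith
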